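/- Let $K$ be an oriented virtual link diagram (for example, a virtual knot diagram) with $n$ classical crossings, all of them positive. Consider the Khovanov--Lee complex of $K$ over $\mathbb{Q}$: it is spanned by the enhanced states of $K$, its differential is built from the Frobenius algebra $\mathbb{Q}[X]/(X^2-1)$ with $\Delta(1)=1\otimes X+X\otimes 1$ and $\Delta(X)=X\otimes X+1\otimes 1$ and from the zero map for single-cycle smoothings, with the bar operation $\overline{X}=-X$, $\overline{1}=1$ applied at cut loci of the canonical source-sink orientation and with the signs that compare the local and global orders of the cycles. It is filtered by the quantum grading $q(s)=i(s)+\lambda(s)+n_+-2n_-$, where $i(s)$ is the number of $B$-smoothings of the enhanced state $s$ and $\lambda(s)$ is the number of its cycles labeled $1$ minus the number of its cycles labeled $X$. Let $s_{\min}(K)$ be the lowest filtration level of the homology $\widehat{Kh}(K)$ with the induced filtration. Let $s_0$ be a canonical generator given by the orientation of $K$ or by its reverse, that is, the state of all oriented smoothings with its cycles decorated by $\mathbf{r}=\frac{1+X}{2}$ and $\mathbf{g}=\frac{1-X}{2}$ according to whether that orientation agrees or disagrees with the source-sink orientation at the marked point of the cycle, and let $r$ be the number of cycles of this state. Let $q(s_0)$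 be the quantum grading of this state with all its cycles decorated by $X$. Then $s_0$ is a cocycle, the filtration degree of the chain $s_0$ and that of its homology class are both $q(s_0)$, and $$ s_{\min}(K) = q(s_0) = -r+n . $$ -/

import Mathlib

namespace VirtualKhovanov

/-! ### Virtual link diagrams and their states -/

/-- An oriented virtual link diagram, up to moves that involve only virtual crossings, given by
its signed oriented Gauss code. There are `n` classical crossings; every classical crossing is
passed twice, and `(c, true)` / `(c, false)` is the passage through `c` along its over / under
strand. `next v` is the passage reached from the passage `v` by following the orientation of the
link along one semi-arc. `positive c` says that the crossing `c` is positive. `free` is the number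
of link components that do not pass through any classical crossing. -/
structure VirtualLinkDiagram where
  n : ℕ
  next : Equiv.Perm (Fin n × Bool)
  positive : Fin n → Bool
  free : ℕ

variable (K : VirtualLinkDiagram)

/-- The half-edges at the classical crossings: `(v, false)` is the half-edge on which the link
enters the crossing in the passage `v`, and `(v, true)` the half-edge on which it leaves. -/
abbrev Dart := (Fin K.n × Bool) × Bool

/-- The other half of the semi-arc to which a half-edge belongs. -/
def opp : Dart K → Dart K
  | (v, true) => (K.next v, false)
  | (v, false) => (K.next.symm v, true)

/-- A state: a choice of smoothing, `false` for `A` and `true` for `B`, at every crossing. -/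
abbrev State := Fin K.n → Bool

/-- The half-edge to which a half-edge is joined, at its crossing, by the smoothing in `s`.
At a positive crossing the `A`-smoothing is the oriented one, at a negative crossing the
`B`-smoothing is. The oriented smoothing joins an incoming half-edge to the outgoing half-edge of
the other strand; the other smoothing joins the two incoming and the two outgoing half-edges. -/
def smooth (s : State K) : Dart K → Dart K
  | ((c, o), e) => if s c = !(K.positive c) then ((c, !o), !e) else ((c, !o), e)

/-- Two half-edges lie on the same cycle of the state `s`. -/
def cycleSetoid (s : State K) : Setoid (Dart K) :=
  Relation.EqvGen.setoid fun x y => y = opp K x ∨ y = smooth K s x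

/-- The cycles of the state `s` that pass through smoothings. -/
abbrev DCycle (s : State K) := Quotient (cycleSetoid K s)

/-- All cycles of the state `s`. -/
abbrev StateCycle (s : State K) := DCycle K s ⊕ Fin K.free

/-- The cycle of the state `s` through a half-edge. -/
def cyc (s : State K) (x : Dart K) : DCycle K s := Quotient.mk _ x

noncomputable instance (s : State K) : Fintype (StateCycle K s) := Fintype.ofFinite _

/-! ### Source-sink orientations and cut loci -/

/-- Draw a crossing with both strands pointing up. `leftward c` is the strand that runs from the
lower right to the upper left: the under strand of a positive, the over strand of a negative
crossing. -/
def leftward (c : Fin K.n) : Bool := !(K.positive c)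

/-- The canonical source-sink orientation at a crossing: both half-edges of the strand from the
lower left to the upper right point into the crossing, and both half-edges of the other strand
point out of it. `agrees x` says that on the half-edge `x` this local orientation agrees with the
orientation of the link. -/
def agrees : Dart K → Bool
  | ((c, o), e) => (o == leftward K c) == e

/-- There is a cut locus on the semi-arc of `x`: the source-sink orientations at its two ends
disagree. -/
def hasCut (x : Dart K) : Bool := xor (agrees K x) (agrees K (opp K x))

/-- `Transport K s x y p`: there is a path along a cycle of `s` from `x` to `y` which crosses an
even (`p = false`) or an odd (`p = true`) number of cut loci. -/
inductive Transport (s : State K) (x : Dart K) : Dart K → Bool → Prop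
  | refl : Transport s x x false
  | smooth {y : Dart K} {p : Bool} : Transport s x y p → Transport s x (smooth K s y) p
  | edge {y : Dart K} {p : Bool} : Transport s x y p → Transport s x (opp K y) (xor p (hasCut K y))

/-! ### Global orientation and global order of the cycles of a state -/

/-- An auxiliary numbering of the half-edges. -/
def code : Dart K → ℕ
  | ((c, o), e) => 4 * (c : ℕ) + 2 * o.toNat + e.toNat

theorem exists_mark (s : State K) (γ : DCycle K s) :
    ∃ x, cyc K s x = γ ∧ ∀ y, cyc K s y = γ → code K x ≤ code K y := by
  classical
  obtain ⟨x₀, hx₀⟩ := Quotient.exists_rep γ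
  obtain ⟨x, hx, hmin⟩ := Finset.exists_min_image
    (Finset.univ.filter fun x : Dart K => cyc K s x = γ) (code K)
    ⟨x₀, Finset.mem_filter.mpr ⟨Finset.mem_univ _, hx₀⟩⟩
  refine ⟨x, (Finset.mem_filter.mp hx).2, fun y hy => hmin y ?_⟩
  exact Finset.mem_filter.mpr ⟨Finset.mem_univ _, hy⟩

/-- The marked point of a cycle, which fixes its global orientation: its first half-edge. -/
noncomputable def mark (s : State K) (γ : DCycle K s) : Dart K :=
  Classical.choose (exists_mark K s γ)

open Classical in
/-- The position (from `0`) of a cycle in the global order of the cycles of `s`, in which cycles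
are listed by their marked points. Cycles without smoothings come last, in a fixed order; they
never take part in a differential. -/
noncomputable def position (s : State K) (γ : DCycle K s) : ℕ :=
  Nat.card {γ' : DCycle K s // code K (mark K s γ') < code K (mark K s γ)}

/-- A half-edge on the arc with local label `1` at the crossing `c`, in either smoothing: the
upper left half-edge. So `1` is the left arc of the oriented smoothing, and the upper arc of the
other one. -/
def first (c : Fin K.n) : Dart K := ((c, leftward K c), true)

/-- A half-edge on the arc with local label `2` at the crossing `c`, in either smoothing: the
lower right half-edge. -/
def second (c : Fin K.n) : Dart K := ((c, leftward K c), false)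

open Classical in
/-- The sign of the permutation between the global order of the cycles of `s` and the local order
at `c`, in which the cycle(s) with local labels `1` and `2` come first, in this order, and all
other cycles keep their relative order. -/
noncomputable def orderSign (s : State K) (c : Fin K.n) : ℚ :=
  let a := position K s (cyc K s (first K c))
  let b := position K s (cyc K s (second K c))
  if cyc K s (first K c) = cyc K s (second K c) then (-1) ^ a
  else if a < b then (-1) ^ (a + b + 1) else (-1) ^ (a + b)

/-! ### The Frobenius algebra `ℚ[X] / (X ^ 2 - 1)` -/

/-- The basis `1`, `X` of the algebra. -/
inductive Label
  | one
  | X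
  deriving DecidableEq

instance : Fintype Label where
  elems := {Label.one, Label.X}
  complete l := by cases l <;> simp

/-- `mulCoeff a b c` is the coefficient of `c` in `m (a ⊗ b)`, where `X * X = 1`. -/
def mulCoeff : Label → Label → Label → ℚ
  | .one, .one, .one => 1
  | .one, .X, .X => 1
  | .X, .one, .X => 1
  | .X, .X, .one => 1
  | _, _, _ => 0

/-- `comulCoeff a b c` is the coefficient of `b ⊗ c` in `Δ a`, where `Δ 1 = 1 ⊗ X + X ⊗ 1` and
`Δ X = X ⊗ X + 1 ⊗ 1`. -/
def comulCoeff : Label → Label → Label → ℚ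
  | .one, .one, .X => 1
  | .one, .X, .one => 1
  | .X, .X, .X => 1
  | .X, .one, .one => 1
  | _, _, _ => 0

open Classical in
/-- The factor by which a label on the cycle through `x` changes on transport between `x` and the
marked point of the cycle: every cut locus on the way applies the bar operation `1 ↦ 1`,
`X ↦ -X`. -/
noncomputable def barSign (s : State K) (x : Dart K) (l : Label) : ℚ :=
  if l = Label.X ∧ Transport K s x (mark K s (cyc K s x)) true then -1 else 1

/-! ### The Khovanov-Lee complex -/

/-- Enhanced states: a state together with a label on each of its cycles. -/
abbrev Enhanced := Σ s : State K, (StateCycle K s → Label)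

/-- Chains: rational linear combinations of enhanced states. -/
abbrev Chain := Enhanced K →₀ ℚ

/-- The state obtained from `s` by putting the `B`-smoothing at `c`. -/
def resmooth (s : State K) (c : Fin K.n) : State K := Function.update s c true

/-- The labelings `l` of `s` and `l'` of the resmoothing at `c` agree on all cycles that do not
pass the site `c`. -/
def AgreeAway (s : State K) (c : Fin K.n) (l : StateCycle K s → Label)
    (l' : StateCycle K (resmooth K s c) → Label) : Prop :=
  (∀ i : Fin K.free, l' (Sum.inr i) = l (Sum.inr i)) ∧
  ∀ x : Dart K, cyc K s x ≠ cyc K s (first K c) → cyc K s x ≠ cyc K s (second K c) →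
    l' (Sum.inl (cyc K (resmooth K s c) x)) = l (Sum.inl (cyc K s x))

open Classical in
/-- The matrix coefficient of the partial differential at the site `c` from `(s, l)` to
`(resmooth K s c, l')`. It is `m` if two cycles merge, `Δ` if a cycle splits, and `η = 0` if a
single cycle is turned into a single cycle, pre- and post-composed with the bar operations that
compare local and global orientation and with the signs that compare local and global order. -/
noncomputable def coeff (s : State K) (c : Fin K.n) (l : StateCycle K s → Label)
    (l' : StateCycle K (resmooth K s c) → Label) : ℚ :=
  let s' := resmooth K s c
  let x := first K c
  let y := second K c
  let a := l (Sum.inl (cyc K s x))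
  let b := l (Sum.inl (cyc K s y))
  let a' := l' (Sum.inl (cyc K s' x))
  let b' := l' (Sum.inl (cyc K s' y))
  if AgreeAway K s c l l' then
    orderSign K s c * orderSign K s' c *
      (if cyc K s x ≠ cyc K s y ∧ cyc K s' x = cyc K s' y then
        barSign K s x a * barSign K s y b * mulCoeff a b a' * barSign K s' x a'
      else if cyc K s x = cyc K s y ∧ cyc K s' x ≠ cyc K s' y then
        barSign K s x a * comulCoeff a a' b' * barSign K s' x a' * barSign K s' y b'
      else 0)
  else 0

open Classical in
/-- The differential of an enhanced state: the sum of the partial differentials at all sites with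
`A`-smoothing. -/
noncomputable def boundary (e : Enhanced K) : Chain K :=
  ∑ c : Fin K.n, if e.1 c = false then
    ∑ l' : (StateCycle K (resmooth K e.1 c) → Label),
      Finsupp.single (⟨resmooth K e.1 c, l'⟩ : Enhanced K) (coeff K e.1 c e.2 l')
    else 0

/-- The differential of the Khovanov-Lee complex. -/
noncomputable def d : Chain K →ₗ[ℚ] Chain K := Finsupp.linearCombination ℚ (boundary K)

/-- Khovanov-Lee homology, summed over all homological degrees. -/
abbrev Homology :=
  LinearMap.ker (d K) ⧸ (LinearMap.range (d K)).submoduleOf (LinearMap.ker (d K))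

/-- The homology class of a cycle of the complex. -/
noncomputable def homologyClass (z : LinearMap.ker (d K)) : Homology K := Submodule.Quotient.mk z

/-! ### The quantum filtration and the lowest filtration level -/

/-- The number of `B`-smoothings. -/
def numB (s : State K) : ℤ := ((Finset.univ.filter fun c => s c = true).card : ℤ)

/-- The number of positive crossings. -/
def nPos : ℤ := ((Finset.univ.filter fun c => K.positive c = true).card : ℤ)

/-- The number of negative crossings. -/
def nNeg : ℤ := ((Finset.univ.filter fun c => K.positive c = false).card : ℤ)

/-- The number of cycles labeled `1` minus the number of cycles labeled `X`. -/
noncomputable def lam (e : Enhanced K) : ℤ :=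
  ∑ γ : StateCycle K e.1, if e.2 γ = Label.one then 1 else -1

/-- The quantum grading `q = j + n₊ - 2 n₋` with `j = i + λ`. -/
noncomputable def q (e : Enhanced K) : ℤ := numB K e.1 + lam K e + nPos K - 2 * nNeg K

/-- The quantum filtration of the chain complex. -/
noncomputable def filtration (j : ℤ) : Submodule ℚ (Chain K) :=
  Finsupp.supported ℚ ℚ {e | j ≤ q K e}

/-- The filtration degree of a chain is `j`. -/
def ChainLevel (x : Chain K) (j : ℤ) : Prop :=
  x ∈ filtration K j ∧ x ∉ filtration K (j + 1)

/-- The induced filtration of the homology: the classes that have a representative in the given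
step of the filtration of the complex. -/
noncomputable def homologyFiltration (j : ℤ) : Submodule ℚ (Homology K) :=
  ((filtration K j).submoduleOf (LinearMap.ker (d K))).map
    ((LinearMap.range (d K)).submoduleOf (LinearMap.ker (d K))).mkQ

/-- The filtration degree of a homology class is `j`. (Such a class is not zero.) -/
def HomologyLevel (y : Homology K) (j : ℤ) : Prop :=
  y ∈ homologyFiltration K j ∧ y ∉ homologyFiltration K (j + 1)

/-- The filtration levels of the homology. -/
def filtrationLevels : Set ℤ := {j | ∃ y : Homology K, HomologyLevel K y j}

/-- The lowest filtration level of the homology. -/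
noncomputable def sMin : ℤ := sInf (filtrationLevels K)

/-! ### Canonical generators -/

/-- The state of all oriented smoothings. -/
def orientedState : State K := fun c => !(K.positive c)

/-- The coefficient of a label in red `= (1 + X) / 2` (for `true`) or green `= (1 - X) / 2`
(for `false`). -/
def colorCoeff (red : Bool) : Label → ℚ
  | .one => 1 / 2
  | .X => if red then 1 / 2 else -1 / 2

/-- The color at the marked point of a cycle of the oriented state: red if there the orientation
of the link (`o = true`) or its reverse (`o = false`) agrees with the source-sink orientation. The
local orientation of a component without classical crossings is that of the link. -/
noncomputable def color (o : Bool) : StateCycle K (orientedState K) → Bool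
  | .inl γ => agrees K (mark K (orientedState K) γ) == o
  | .inr _ => o

open Classical in
/-- The canonical generator given by the orientation of the link (`o = true`) or by its reverse
(`o = false`): the oriented state with its cycles decorated by red and green. -/
noncomputable def canonicalGenerator (o : Bool) : Chain K :=
  ∑ l : (StateCycle K (orientedState K) → Label),
    Finsupp.single (⟨orientedState K, l⟩ : Enhanced K)
      (∏ γ : StateCycle K (orientedState K), colorCoeff (color K o γ) (l γ))

/-- The oriented state with all its cycles decorated by `X`. -/
def orientedX : Enhanced K := ⟨orientedState K, fun _ => Label.X⟩

end VirtualKhovanov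

open VirtualKhovanov

/-!
A canonical generator is a cocycle because transporting its decoration to a crossing always gives
red on one side and green on the other, and `r * g = 0`; resmoothing the oriented state never splits
a cycle, since following the orientation away from a crossing one must return to it.

Changing one smoothing changes the number of cycles by at most one, so for a positive diagram the
oriented state, in which all smoothings are `A`, decorated by `X` has the lowest quantum grading of
all enhanced states. It has a nonzero coefficient in each canonical generator and, having no
`B`-smoothing, is in the support of no coboundary. Hence no representative of the class of a
canonical generator lies deeper in the filtration.
-/

namespace VirtualKhovanov

section SumUpdate

variable {ι : Type*} [Fintype ι] [DecidableEq ι]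

theorem sum_sum_update {π : ι → Type*} [∀ i, Fintype (π i)] {M : Type*} [AddCommMonoid M]
    (i : ι) (F : (∀ i, π i) → M) :
    ∑ l, ∑ a, F (Function.update l i a) = Fintype.card (π i) • ∑ l, F l := by
  have hswap : Function.Involutive fun p : (∀ i, π i) × π i =>
      (Function.update p.1 i p.2, p.1 i) :=
    fun p => by simp
  calc ∑ l, ∑ a, F (Function.update l i a)
      = ∑ p : (∀ i, π i) × π i, F (Function.update p.1 i p.2) := by rw [Fintype.sum_prod_type]
    _ = ∑ p : (∀ i, π i) × π i, F p.1 := hswap.bijective.sum_comp fun p => F p.1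
    _ = Fintype.card (π i) • ∑ l, F l := by
      simp only [Fintype.sum_prod_type, Finset.sum_const, Finset.card_univ, Finset.smul_sum]

theorem sum_eq_zero_of_sum_update_update {π : ι → Type*} [∀ i, Fintype (π i)] {M : Type*}
    [AddCommMonoid M] [IsAddTorsionFree M] (i j : ι) (F : (∀ i, π i) → M)
    (h : ∀ l, ∑ a, ∑ b, F (Function.update (Function.update l i a) j b) = 0) :
    ∑ l, F l = 0 := by
  obtain _ | ⟨⟨l₀⟩⟩ := isEmpty_or_nonempty (∀ i, π i)
  · exact Fintype.sum_empty _
  have hcard (k : ι) : Fintype.card (π k) ≠ 0 := (Fintype.card_pos_iff.mpr ⟨l₀ k⟩).ne'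
  have hsum : Fintype.card (π i) • Fintype.card (π j) • ∑ l, F l = 0 := by
    rw [← sum_sum_update j F, ← sum_sum_update i fun l => ∑ b, F (Function.update l j b)]
    exact Finset.sum_eq_zero fun l _ => h l
  simpa [hcard] using hsum

theorem sum_prod_mul_eq_zero {π : ι → Type*} [∀ i, Fintype (π i)] {R : Type*} [CommSemiring R]
    [IsAddTorsionFree R] {i j : ι} (hij : i ≠ j) (f : ∀ k, π k → R) (G : (∀ k, π k) → R)
    (h : ∀ l, ∑ a, ∑ b, f i a * f j b * G (Function.update (Function.update l i a) j b) = 0) :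
    ∑ l, (∏ k, f k (l k)) * G l = 0 := by
  refine sum_eq_zero_of_sum_update_update i j _ fun l => ?_
  have hprod (a : π i) (b : π j) : ∏ k, f k (Function.update (Function.update l i a) j b k) =
      f i a * f j b * ∏ k ∈ (Finset.univ.erase i).erase j, f k (l k) := by
    rw [← Finset.mul_prod_erase _ _ (Finset.mem_univ i),
      ← Finset.mul_prod_erase _ _ (Finset.mem_erase.mpr ⟨hij.symm, Finset.mem_univ j⟩),
      Function.update_of_ne hij, Function.update_self, Function.update_self, mul_assoc]
    congr 2
    refine Finset.prod_congr rfl fun k hk => ?_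
    obtain ⟨hkj, hki, -⟩ : k ≠ j ∧ k ≠ i ∧ _ := by simpa only [Finset.mem_erase] using hk
    rw [Function.update_of_ne hkj, Function.update_of_ne hki]
  simp only [hprod, mul_right_comm _ (Finset.prod _ _), ← Finset.sum_mul, h, zero_mul]

end SumUpdate

variable {K : VirtualLinkDiagram}

/-! ### Cycles of states -/

/-- The cycle of the state `s` through a half-edge, as an element of the set of all cycles of `s`,
which includes those without smoothings. -/
abbrev stateCyc (s : State K) (x : Dart K) : StateCycle K s := Sum.inl (cyc K s x)

theorem opp_opp (x : Dart K) : opp K (opp K x) = x := by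
  rcases x with ⟨v, _ | _⟩ <;> simp [opp]

theorem smooth_smooth (s : State K) (x : Dart K) : smooth K s (smooth K s x) = x := by
  rcases x with ⟨⟨c, o⟩, e⟩
  by_cases h : s c = !(K.positive c) <;> simp [smooth, h]

theorem smooth_congr {s s' : State K} {x : Dart K} (h : s x.1.1 = s' x.1.1) :
    smooth K s x = smooth K s' x := by
  simp only [smooth, h]

theorem smooth_of_eq_orientedState {s : State K} {x : Dart K}
    (h : s x.1.1 = orientedState K x.1.1) : smooth K s x = ((x.1.1, !x.1.2), !x.2) :=
  if_pos h

theorem smooth_of_ne_orientedState {s : State K} {x : Dart K}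
    (h : s x.1.1 ≠ orientedState K x.1.1) : smooth K s x = ((x.1.1, !x.1.2), x.2) :=
  if_neg h

theorem smooth_fst_fst (s : State K) (x : Dart K) : (smooth K s x).1.1 = x.1.1 := by
  simp only [smooth]
  split_ifs <;> rfl

theorem cyc_surjective (s : State K) : Function.Surjective (cyc K s) := Quotient.exists_rep

theorem cyc_opp (s : State K) (x : Dart K) : cyc K s (opp K x) = cyc K s x :=
  (Quotient.sound (s := cycleSetoid K s) (Relation.EqvGen.rel _ _ (Or.inl rfl))).symm

theorem cyc_smooth (s : State K) (x : Dart K) : cyc K s (smooth K s x) = cyc K s x :=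
  (Quotient.sound (s := cycleSetoid K s) (Relation.EqvGen.rel _ _ (Or.inr rfl))).symm

theorem eq_of_cyc_eq {α : Type*} {s : State K} {f : Dart K → α}
    (hopp : ∀ x, f (opp K x) = f x) (hsmooth : ∀ x, f (smooth K s x) = f x) {x y : Dart K}
    (h : cyc K s x = cyc K s y) : f x = f y := by
  have hle : cycleSetoid K s ≤ Setoid.ker f := by
    refine Setoid.eqvGen_le ?_
    rintro x _ (rfl | rfl)
    · exact (hopp x).symm
    · exact (hsmooth x).symm
  exact hle (Quotient.exact h)

theorem cyc_eq_first_or_second (s : State K) {c : Fin K.n} {x : Dart K} (hx : x.1.1 = c) :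
    cyc K s x = cyc K s (first K c) ∨ cyc K s x = cyc K s (second K c) := by
  have hleft (e : Bool) : cyc K s ((c, leftward K c), e) = cyc K s (first K c) ∨
      cyc K s ((c, leftward K c), e) = cyc K s (second K c) := by
    cases e
    exacts [Or.inr rfl, Or.inl rfl]
  rcases x with ⟨⟨c, o⟩, e⟩
  obtain rfl := hx
  obtain rfl | ho := eq_or_ne o (leftward K c)
  · exact hleft e
  · rw [← cyc_smooth]
    simp only [smooth, Bool.not_eq_eq_eq_not.mpr (Bool.eq_not.mpr ho)]
    split_ifs
    exacts [hleft _, hleft _]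

theorem eq_of_cyc_eq_of_eq_off {α : Type*} {s s' : State K} {c : Fin K.n}
    (hs : ∀ c' ≠ c, s' c' = s c') {f : DCycle K s' → α}
    (hf : f (cyc K s' (first K c)) = f (cyc K s' (second K c))) {x y : Dart K}
    (h : cyc K s x = cyc K s y) : f (cyc K s' x) = f (cyc K s' y) := by
  have hfc {x : Dart K} (hx : x.1.1 = c) : f (cyc K s' x) = f (cyc K s' (first K c)) := by
    rcases cyc_eq_first_or_second s' hx with h | h
    · rw [h]
    · rw [h, hf]
  refine eq_of_cyc_eq (f := fun x => f (cyc K s' x)) (fun x => by rw [cyc_opp]) (fun x => ?_) h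
  by_cases hx : x.1.1 = c
  · rw [hfc hx, hfc ((smooth_fst_fst s x).trans hx)]
  · rw [← smooth_congr (hs _ hx), cyc_smooth]

theorem card_stateCycle_le_add_one {s s' : State K} {c : Fin K.n}
    (hs : ∀ c' ≠ c, s' c' = s c') :
    Nat.card (StateCycle K s') ≤ Nat.card (StateCycle K s) + 1 := by
  classical
  let merge (γ : DCycle K s') : DCycle K s' :=
    if γ = cyc K s' (second K c) then cyc K s' (first K c) else γ
  have hmerge : merge (cyc K s' (first K c)) = merge (cyc K s' (second K c)) := by
    simp [merge]
  let G (γ : Option (DCycle K s)) : DCycle K s' :=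
    γ.elim (cyc K s' (second K c)) <| Quotient.lift (fun x => merge (cyc K s' x)) fun _ _ h =>
      eq_of_cyc_eq_of_eq_off hs hmerge (Quotient.sound h)
  have hG : Function.Surjective G := by
    intro γ
    obtain ⟨x, rfl⟩ := cyc_surjective s' γ
    by_cases hx : cyc K s' x = cyc K s' (second K c)
    · exact ⟨none, hx.symm⟩
    · exact ⟨some (cyc K s x), if_neg hx⟩
  have hcard := Nat.card_le_card_of_surjective G hG
  rw [Finite.card_option] at hcard
  rw [Nat.card_sum, Nat.card_sum]
  omega

theorem card_stateCycle_le_add_hammingDist (s s' : State K) :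
    Nat.card (StateCycle K s') ≤ Nat.card (StateCycle K s) + hammingDist s' s := by
  suffices h : ∀ (F : Finset (Fin K.n)) (s' : State K), (∀ c ∉ F, s' c = s c) →
      Nat.card (StateCycle K s') ≤ Nat.card (StateCycle K s) + F.card from
    h _ s' fun c hc => by simpa using hc
  intro F
  induction F using Finset.induction_on with
  | empty =>
    intro s' hs'
    rw [funext fun c => hs' c (Finset.notMem_empty c), Finset.card_empty, add_zero]
  | insert c F hc ih =>
    intro s' hs'
    have hF : ∀ c' ∉ F, Function.update s' c (s c) c' = s c' := by
      intro c' hc'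
      obtain rfl | hne := eq_or_ne c' c
      · exact Function.update_self ..
      · rw [Function.update_of_ne hne, hs' c' (by simp [hne, hc'])]
    have hstep : Nat.card (StateCycle K s') ≤
        Nat.card (StateCycle K (Function.update s' c (s c))) + 1 :=
      card_stateCycle_le_add_one fun c' hne => (Function.update_of_ne hne _ _).symm
    have hrest := ih _ hF
    rw [Finset.card_insert_of_notMem hc]
    omega

/-! ### Resmoothings of the oriented state -/

theorem cyc_in_eq_cyc_second {s : State K} {c : Fin K.n} (hc : s c ≠ orientedState K c)
    (o : Bool) : cyc K s ((c, o), false) = cyc K s (second K c) := by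
  obtain rfl | ho := eq_or_ne o (leftward K c)
  · rfl
  · rw [← cyc_smooth, smooth_of_ne_orientedState hc]
    simp only [Bool.not_eq_eq_eq_not.mpr (Bool.eq_not.mpr ho), second]

/-- The successor of a passage along the oriented smoothings: from the outgoing half-edge of `v`,
the oriented state leads to the outgoing half-edge of `orientedNext K v`. -/
def orientedNext (K : VirtualLinkDiagram) : Equiv.Perm (Fin K.n × Bool) :=
  K.next.trans ((Equiv.refl _).prodCongr Equiv.boolNot)

theorem cyc_orientedNext {s : State K} {v : Fin K.n × Bool}
    (h : s (K.next v).1 = orientedState K (K.next v).1) :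
    cyc K s (orientedNext K v, true) = cyc K s (v, true) :=
  calc cyc K s (orientedNext K v, true)
      = cyc K s (smooth K s (K.next v, false)) := by rw [smooth_of_eq_orientedState h]; rfl
    _ = cyc K s (K.next v, false) := cyc_smooth s _
    _ = cyc K s (v, true) := cyc_opp s (v, true)

theorem cyc_first_eq_cyc_second {s : State K} {c : Fin K.n} (hc : s c ≠ orientedState K c)
    (hs : ∀ c' ≠ c, s c' = orientedState K c') :
    cyc K s (first K c) = cyc K s (second K c) := by
  let U : Set (Fin K.n × Bool) := {v | cyc K s (v, true) = cyc K s (first K c)}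
  -- If following the orientation never led back to `c`, the permutation `orientedNext` would
  -- preserve `U`, and so would its inverse; but the predecessor of the starting passage does
  -- lead to `c`.
  obtain ⟨v, hvU, hvc⟩ : ∃ v ∈ U, (K.next v).1 = c := by
    by_contra! hleave
    have hmaps : Set.MapsTo (orientedNext K) U U := fun v hv =>
      (cyc_orientedNext (hs _ (hleave v hv))).trans hv
    have hpred : (orientedNext K).symm (c, leftward K c) ∈ U :=
      Equiv.Perm.perm_symm_mapsTo_of_mapsTo _ hmaps rfl
    have hnext := (orientedNext K).apply_symm_apply (c, leftward K c)
    exact hleave _ hpred (congrArg Prod.fst hnext)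
  calc cyc K s (first K c)
      = cyc K s (v, true) := hvU.symm
    _ = cyc K s (K.next v, false) := (cyc_opp s (v, true)).symm
    _ = cyc K s ((c, (K.next v).2), false) := by rw [← hvc]
    _ = cyc K s (second K c) := cyc_in_eq_cyc_second hc _

theorem cyc_resmooth_orientedState {c : Fin K.n} (hc : orientedState K c = false) :
    cyc K (resmooth K (orientedState K) c) (first K c) =
      cyc K (resmooth K (orientedState K) c) (second K c) :=
  cyc_first_eq_cyc_second (by simp [resmooth, hc])
    fun _ hne => Function.update_of_ne hne _ _

/-! ### Canonical generators -/

theorem exists_transport {s : State K} {x y : Dart K} (h : cyc K s x = cyc K s y) :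
    ∃ p, Transport K s x y p := by
  have hopp (y : Dart K) : (∃ p, Transport K s x y p) → ∃ p, Transport K s x (opp K y) p :=
    fun ⟨_, hp⟩ => ⟨_, hp.edge⟩
  have hsmooth (y : Dart K) :
      (∃ p, Transport K s x y p) → ∃ p, Transport K s x (smooth K s y) p :=
    fun ⟨_, hp⟩ => ⟨_, hp.smooth⟩
  have hxy : (∃ p, Transport K s x x p) = ∃ p, Transport K s x y p :=
    eq_of_cyc_eq (f := fun y => ∃ p, Transport K s x y p)
      (fun y => propext ⟨fun h => opp_opp y ▸ hopp _ h, hopp y⟩)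
      (fun y => propext ⟨fun h => smooth_smooth s y ▸ hsmooth _ h, hsmooth y⟩) h
  exact hxy ▸ ⟨false, Transport.refl⟩

theorem agrees_smooth_orientedState (x : Dart K) :
    agrees K (smooth K (orientedState K) x) = agrees K x := by
  rw [smooth_of_eq_orientedState rfl]
  rcases x with ⟨⟨c, o⟩, e⟩
  simp only [agrees]
  cases o <;> cases e <;> cases leftward K c <;> rfl

theorem agrees_of_transport {x y : Dart K} {p : Bool}
    (h : Transport K (orientedState K) x y p) : agrees K y = xor (agrees K x) p := by
  induction h with
  | refl => exact (Bool.xor_false _).symm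
  | smooth _ ih => rw [agrees_smooth_orientedState, ih]
  | edge _ ih => rw [hasCut, ← Bool.xor_assoc, ← ih, ← Bool.xor_assoc, Bool.xor_self,
      Bool.false_xor]

theorem transport_orientedState_iff {x y : Dart K} {p : Bool}
    (h : cyc K (orientedState K) x = cyc K (orientedState K) y) :
    Transport K (orientedState K) x y p ↔ agrees K y = xor (agrees K x) p := by
  refine ⟨agrees_of_transport, fun hp => ?_⟩
  obtain ⟨p', hp'⟩ := exists_transport h
  have hpp' : p = p' :=
    Bool.xor_right_inj.mp (hp.symm.trans (agrees_of_transport hp'))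
  rwa [hpp']

theorem cyc_mark (s : State K) (γ : DCycle K s) : cyc K s (mark K s γ) = γ :=
  (Classical.choose_spec (exists_mark K s γ)).1

/-- Holds because the bar operation exchanges red and green. -/
theorem colorCoeff_color_mul_barSign (o : Bool) (x : Dart K) (a : Label) :
    colorCoeff (color K o (stateCyc (orientedState K) x)) a *
      barSign K (orientedState K) x a = colorCoeff (agrees K x == o) a := by
  simp only [color, barSign, transport_orientedState_iff (cyc_mark _ _).symm]
  generalize agrees K (mark K (orientedState K) (cyc K (orientedState K) x)) = m
  cases a <;> cases m <;> cases agrees K x <;> cases o <;> simp [colorCoeff, neg_div]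

theorem agrees_first (c : Fin K.n) : agrees K (first K c) = true := by
  simp [agrees, first]

theorem agrees_second (c : Fin K.n) : agrees K (second K c) = false := by
  simp [agrees, second]

theorem red_mul_green_eq_zero (r : Bool) (c : Label) :
    ∑ a, ∑ b, colorCoeff r a * colorCoeff (!r) b * mulCoeff a b c = 0 := by
  have huniv : (Finset.univ : Finset Label) = {.one, .X} := rfl
  cases r <;> cases c <;> simp [huniv, colorCoeff, mulCoeff, neg_div]

theorem agreeAway_congr {s : State K} {c : Fin K.n} {l₁ l₂ : StateCycle K s → Label}
    {l' : StateCycle K (resmooth K s c) → Label}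
    (h : ∀ γ, γ ≠ stateCyc s (first K c) → γ ≠ stateCyc s (second K c) → l₁ γ = l₂ γ) :
    AgreeAway K s c l₁ l' ↔ AgreeAway K s c l₂ l' := by
  refine and_congr (forall_congr' fun i => ?_) (forall_congr' fun x => forall_congr' fun h₁ =>
    forall_congr' fun h₂ => ?_)
  · rw [h _ Sum.inr_ne_inl Sum.inr_ne_inl]
  · rw [h _ (Sum.inl_injective.ne h₁) (Sum.inl_injective.ne h₂)]

theorem coeff_eq_zero_of_not_agreeAway {s : State K} {c : Fin K.n} {l : StateCycle K s → Label}
    {l' : StateCycle K (resmooth K s c) → Label} (h : ¬ AgreeAway K s c l l') :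
    coeff K s c l l' = 0 :=
  if_neg h

theorem coeff_eq_zero_of_single_cycle {s : State K} {c : Fin K.n}
    (hs : cyc K s (first K c) = cyc K s (second K c))
    (hs' : cyc K (resmooth K s c) (first K c) = cyc K (resmooth K s c) (second K c))
    (l : StateCycle K s → Label) (l' : StateCycle K (resmooth K s c) → Label) :
    coeff K s c l l' = 0 := by
  simp [coeff, hs, hs']

theorem coeff_of_merge {s : State K} {c : Fin K.n}
    (hs : cyc K s (first K c) ≠ cyc K s (second K c))
    (hs' : cyc K (resmooth K s c) (first K c) = cyc K (resmooth K s c) (second K c))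
    {l : StateCycle K s → Label} {l' : StateCycle K (resmooth K s c) → Label}
    (h : AgreeAway K s c l l') :
    coeff K s c l l' = orderSign K s c * orderSign K (resmooth K s c) c *
      (barSign K s (first K c) (l (stateCyc s (first K c))) *
        barSign K s (second K c) (l (stateCyc s (second K c))) *
        mulCoeff (l (stateCyc s (first K c))) (l (stateCyc s (second K c)))
          (l' (stateCyc (resmooth K s c) (first K c))) *
        barSign K (resmooth K s c) (first K c)
          (l' (stateCyc (resmooth K s c) (first K c)))) := by
  simp only [coeff, if_pos h, if_pos (And.intro hs hs')]

theorem colorCoeff_mul_coeff_of_merge (o : Bool) {c : Fin K.n}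
    (hs : cyc K (orientedState K) (first K c) ≠ cyc K (orientedState K) (second K c))
    (hs' : cyc K (resmooth K (orientedState K) c) (first K c) =
      cyc K (resmooth K (orientedState K) c) (second K c))
    {l : StateCycle K (orientedState K) → Label}
    {l' : StateCycle K (resmooth K (orientedState K) c) → Label}
    (h : AgreeAway K (orientedState K) c l l') {a b : Label}
    (ha : l (stateCyc (orientedState K) (first K c)) = a)
    (hb : l (stateCyc (orientedState K) (second K c)) = b) :
    colorCoeff (color K o (stateCyc (orientedState K) (first K c))) a *
        colorCoeff (color K o (stateCyc (orientedState K) (second K c))) b *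
        coeff K (orientedState K) c l l' =
      orderSign K (orientedState K) c * orderSign K (resmooth K (orientedState K) c) c *
        barSign K (resmooth K (orientedState K) c) (first K c) (l' (stateCyc _ (first K c))) *
        (colorCoeff o a * colorCoeff (!o) b * mulCoeff a b (l' (stateCyc _ (first K c)))) := by
  have hfirst := colorCoeff_color_mul_barSign o (first K c) a
  have hsecond := colorCoeff_color_mul_barSign o (second K c) b
  rw [agrees_first, Bool.true_beq] at hfirst
  rw [agrees_second, Bool.false_beq] at hsecond
  rw [coeff_of_merge hs hs' h, ha, hb, ← hfirst, ← hsecond]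
  ring

open Classical in
theorem sum_prod_colorCoeff_mul_coeff_eq_zero (o : Bool) {c : Fin K.n}
    (hc : orientedState K c = false)
    (l' : StateCycle K (resmooth K (orientedState K) c) → Label) :
    ∑ l : StateCycle K (orientedState K) → Label,
      (∏ γ, colorCoeff (color K o γ) (l γ)) * coeff K (orientedState K) c l l' = 0 := by
  have hs' := cyc_resmooth_orientedState hc
  by_cases hs : cyc K (orientedState K) (first K c) = cyc K (orientedState K) (second K c)
  · simp only [coeff_eq_zero_of_single_cycle hs hs', mul_zero, Finset.sum_const_zero]
  have hne := (Sum.inl_injective (β := Fin K.free)).ne hs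
  refine sum_prod_mul_eq_zero hne (fun γ => colorCoeff (color K o γ)) _ fun l => ?_
  have hagree (a b : Label) : AgreeAway K (orientedState K) c
      (Function.update (Function.update l (stateCyc _ (first K c)) a)
        (stateCyc _ (second K c)) b) l' ↔ AgreeAway K (orientedState K) c l l' :=
    agreeAway_congr fun γ h₁ h₂ => by
      rw [Function.update_of_ne h₂, Function.update_of_ne h₁]
  by_cases hl : AgreeAway K (orientedState K) c l l'
  · simp only [colorCoeff_mul_coeff_of_merge o hs hs' ((hagree _ _).mpr hl)
      ((Function.update_of_ne hne _ _).trans (Function.update_self ..)) (Function.update_self ..),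
      ← Finset.mul_sum, red_mul_green_eq_zero, mul_zero]
  · simp only [coeff_eq_zero_of_not_agreeAway ((hagree _ _).not.mpr hl), mul_zero,
      Finset.sum_const_zero]

open Classical in
theorem boundary_mk (s : State K) (l : StateCycle K s → Label) :
    boundary K ⟨s, l⟩ = ∑ c, if s c = false then
      ∑ l' : StateCycle K (resmooth K s c) → Label,
        Finsupp.single (⟨resmooth K s c, l'⟩ : Enhanced K) (coeff K s c l l') else 0 :=
  rfl

theorem d_canonicalGenerator (K : VirtualLinkDiagram) (o : Bool) :
    d K (canonicalGenerator K o) = 0 := by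
  classical
  simp only [canonicalGenerator, map_sum, d, Finsupp.linearCombination_single, boundary_mk,
    Finset.smul_sum]
  rw [Finset.sum_comm]
  refine Finset.sum_eq_zero fun c _ => ?_
  split_ifs with hc
  · simp only [Finset.smul_sum, Finsupp.smul_single, smul_eq_mul]
    rw [Finset.sum_comm]
    refine Finset.sum_eq_zero fun l' _ => ?_
    rw [← Finsupp.single_finsetSum, sum_prod_colorCoeff_mul_coeff_eq_zero o hc, Finsupp.single_zero]
  · simp only [smul_zero, Finset.sum_const_zero]

theorem canonicalGenerator_apply (o : Bool) (l : StateCycle K (orientedState K) → Label) :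
    canonicalGenerator K o ⟨orientedState K, l⟩ = ∏ γ, colorCoeff (color K o γ) (l γ) := by
  classical
  rw [canonicalGenerator, Finsupp.finsetSum_apply, Finset.sum_eq_single l]
  · exact Finsupp.single_eq_same
  · exact fun l₁ _ hne => Finsupp.single_eq_of_ne fun h => hne (sigma_mk_injective h).symm
  · exact fun h => absurd (Finset.mem_univ l) h

theorem colorCoeff_ne_zero (r : Bool) (a : Label) : colorCoeff r a ≠ 0 := by
  cases a <;> cases r <;> norm_num [colorCoeff]

theorem canonicalGenerator_apply_orientedX_ne_zero (o : Bool) :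
    canonicalGenerator K o (orientedX K) ≠ 0 := by
  rw [orientedX, canonicalGenerator_apply]
  exact Finset.prod_ne_zero_iff.mpr fun γ _ => colorCoeff_ne_zero _ _

/-! ### The quantum filtration -/

theorem boundary_apply_of_forall_false (e' : Enhanced K) {e : Enhanced K}
    (he : ∀ c, e.1 c = false) : boundary K e' e = 0 := by
  have hne (c : Fin K.n) (l' : StateCycle K (resmooth K e'.1 c) → Label) :
      e ≠ ⟨resmooth K e'.1 c, l'⟩ := by
    rintro rfl
    simpa [resmooth] using he c
  rw [boundary, Finsupp.finsetSum_apply]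
  refine Finset.sum_eq_zero fun c _ => ?_
  split_ifs
  · rw [Finsupp.finsetSum_apply]
    exact Finset.sum_eq_zero fun l' _ => Finsupp.single_eq_of_ne (hne c l')
  · rfl

theorem d_apply_of_forall_false (x : Chain K) {e : Enhanced K} (he : ∀ c, e.1 c = false) :
    d K x e = 0 := by
  rw [d, Finsupp.linearCombination_apply, Finsupp.sum, Finsupp.finsetSum_apply]
  exact Finset.sum_eq_zero fun e' _ => by
    rw [Finsupp.smul_apply, boundary_apply_of_forall_false e' he, smul_zero]

theorem notMem_filtration_of_apply_ne_zero {x : Chain K} {e : Enhanced K} (hx : x e ≠ 0) :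
    x ∉ filtration K (q K e + 1) := fun h =>
  (Int.lt_succ (q K e)).not_ge ((Finsupp.mem_supported ℚ x).mp h (Finsupp.mem_support_iff.mpr hx))

theorem homologyClass_notMem_homologyFiltration {z : LinearMap.ker (d K)} {e : Enhanced K}
    (he : ∀ c, e.1 c = false) (hz : (z : Chain K) e ≠ 0) :
    homologyClass K z ∉ homologyFiltration K (q K e + 1) := by
  rintro ⟨z', hz', hclass⟩
  obtain ⟨w, hw⟩ : (z' : Chain K) - z ∈ LinearMap.range (d K) :=
    (Submodule.Quotient.eq ((LinearMap.range (d K)).submoduleOf (LinearMap.ker (d K)))).mp hclass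
  have hsub : (z' : Chain K) e - (z : Chain K) e = 0 := by
    rw [← Finsupp.sub_apply, ← hw, d_apply_of_forall_false w he]
  exact notMem_filtration_of_apply_ne_zero (sub_eq_zero.mp hsub ▸ hz) hz'

theorem filtration_eq_top {j : ℤ} (hj : ∀ e, j ≤ q K e) : filtration K j = ⊤ := by
  rw [filtration, Set.eq_univ_of_forall (s := {e | j ≤ q K e}) hj, Finsupp.supported_univ]

theorem homologyFiltration_eq_top {j : ℤ} (hj : ∀ e, j ≤ q K e) :
    homologyFiltration K j = ⊤ := by
  have htop : (⊤ : Submodule ℚ (Chain K)).submoduleOf (LinearMap.ker (d K)) = ⊤ :=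
    Submodule.comap_top _
  rw [homologyFiltration, filtration_eq_top hj, htop, Submodule.map_top, Submodule.range_mkQ]

theorem isLeast_filtrationLevels {y : Homology K} {j : ℤ} (hy : HomologyLevel K y j)
    (hj : ∀ e, j ≤ q K e) : IsLeast (filtrationLevels K) j := by
  refine ⟨⟨y, hy⟩, ?_⟩
  rintro i ⟨y', -, hy'⟩
  by_contra! hi
  rw [homologyFiltration_eq_top fun e => (Int.add_one_le_of_lt hi).trans (hj e)] at hy'
  exact hy' Submodule.mem_top

/-! ### The quantum grading -/

theorem neg_card_le_lam (e : Enhanced K) : -(Nat.card (StateCycle K e.1) : ℤ) ≤ lam K e := by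
  have h : ∑ _γ : StateCycle K e.1, (-1 : ℤ) ≤ lam K e :=
    Finset.sum_le_sum fun γ _ => by split_ifs <;> norm_num
  simpa [Nat.card_eq_fintype_card] using h

theorem lam_const_X (s : State K) :
    lam K ⟨s, fun _ => Label.X⟩ = -(Nat.card (StateCycle K s) : ℤ) := by
  simp [lam, Nat.card_eq_fintype_card]

theorem neg_card_add_le_q (e : Enhanced K) :
    -(Nat.card (StateCycle K fun _ => false) : ℤ) + nPos K - 2 * nNeg K ≤ q K e := by
  have hcard := card_stateCycle_le_add_hammingDist (fun _ => false) e.1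
  have hdist : numB K e.1 = hammingDist e.1 fun _ => false := by
    simp only [numB, hammingDist, ne_eq, Bool.not_eq_false]
  have hlam := neg_card_le_lam e
  rw [q, hdist]
  omega

theorem q_orientedX (K : VirtualLinkDiagram) :
    q K (orientedX K) = -(Nat.card (StateCycle K (orientedState K)) : ℤ) + nPos K - nNeg K := by
  have hB : numB K (orientedState K) = nNeg K := by
    simp only [numB, nNeg, orientedState, Bool.not_eq_true']
  rw [q, orientedX, hB, lam_const_X]
  ring

/-! ### Positive diagrams -/

theorem nPos_of_positive (hK : ∀ c : Fin K.n, K.positive c = true) : nPos K = K.n := by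
  simp [nPos, hK]

theorem nNeg_of_positive (hK : ∀ c : Fin K.n, K.positive c = true) : nNeg K = 0 := by
  simp [nNeg, hK]

theorem orientedState_of_positive (hK : ∀ c : Fin K.n, K.positive c = true) :
    orientedState K = fun _ => false := by
  funext c
  simp [orientedState, hK]

theorem q_orientedX_le (hK : ∀ c : Fin K.n, K.positive c = true) (e : Enhanced K) :
    q K (orientedX K) ≤ q K e := by
  have h := neg_card_add_le_q e
  rw [← orientedState_of_positive hK] at h
  rw [q_orientedX]
  linarith [nNeg_of_positive hK]

theorem chainLevel_canonicalGenerator (hK : ∀ c : Fin K.n, K.positive c = true) (o : Bool) :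
    ChainLevel K (canonicalGenerator K o) (q K (orientedX K)) := by
  refine ⟨?_, notMem_filtration_of_apply_ne_zero (canonicalGenerator_apply_orientedX_ne_zero o)⟩
  rw [filtration_eq_top (q_orientedX_le hK)]
  exact Submodule.mem_top

theorem homologyLevel_canonicalGenerator (hK : ∀ c : Fin K.n, K.positive c = true) (o : Bool) :
    HomologyLevel K (homologyClass K ⟨canonicalGenerator K o, d_canonicalGenerator K o⟩)
      (q K (orientedX K)) := by
  refine ⟨?_, homologyClass_notMem_homologyFiltration
    (congrFun (orientedState_of_positive hK)) (canonicalGenerator_apply_orientedX_ne_zero o)⟩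
  rw [homologyFiltration_eq_top (q_orientedX_le hK)]
  exact Submodule.mem_top

end VirtualKhovanov

theorem mainTheorem8 (K : VirtualLinkDiagram) (hK : ∀ c : Fin K.n, K.positive c = true) :
    -- the lowest filtration level exists and equals the quantum grading of the oriented state
    -- with all cycles decorated by X, which is - r + n
    IsLeast (filtrationLevels K) (sMin K) ∧
    sMin K = q K (orientedX K) ∧
    q K (orientedX K) = - (Nat.card (StateCycle K (orientedState K)) : ℤ) + (K.n : ℤ) ∧
    -- this is also the filtration degree of either canonical generator and of its class
    ∀ o : Bool, ChainLevel K (canonicalGenerator K o) (sMin K) ∧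
      ∃ h : canonicalGenerator K o ∈ LinearMap.ker (d K),
        HomologyLevel K (homologyClass K ⟨canonicalGenerator K o, h⟩) (sMin K) := by
  have hleast : IsLeast (filtrationLevels K) (q K (orientedX K)) :=
    isLeast_filtrationLevels (homologyLevel_canonicalGenerator hK true) (q_orientedX_le hK)
  have hmin : sMin K = q K (orientedX K) := hleast.csInf_eq
  rw [hmin]
  refine ⟨hleast, rfl, ?_, fun o => ⟨chainLevel_canonicalGenerator hK o,
    d_canonicalGenerator K o, homologyLevel_canonicalGenerator hK o⟩⟩
  rw [q_orientedX, nPos_of_positive hK, nNeg_of_positive hK, sub_zero]
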